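/- Let $N\in\mathbb N$, let $k>N/2+2$ be a real number, and let $u_0\in H^k(\mathbb R^N;\mathbb R^N)$ (identified with its continuous representative, which is of class $C^2$) be odd, $u_0(-x)=-u_0(x)$ for all $x$, with $\operatorname{div}u_0(0)<0$. Consider the zero dispersion ($\alpha=0$) Euler–Poincaré equations $$\partial_t u+\operatorname{div}(u\otimes u)+\tfrac12\nabla|u|^2=0,\qquad u(\cdot,0)=u_0,$$ that is, $\partial_t u_i+\sum_{j}\partial_j(u_iu_j)+\tfrac12\partial_i|u|^2=0$ for $i=1,\dots,N$. A classical solution on $[0,T)$, $0<T<\infty$, is a function $u\in C([0,T);H^k(\mathbb R^N;\mathbb R^N))$ that is $C^1$ on $[0,T)\times\mathbb R^N$, satisfies the equations pointwise for $0<t<T$, and has $u(\cdot,0)=u_0$. Let $T_*\in[0,\infty]$ be the maximal time of existence of the classical solution, i.e. the supremum of all $T$ for which there is a classical solution on $[0,T)$. Then the classical solution blows up in finite time, in the sense that $T_*<\infty$; more precisely, $$T_*\le\frac{1}{|\operatorname{div}u_0(0)|}.$$ -/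

import Mathlib

open MeasureTheory Set
open scoped ENNReal

noncomputable section

namespace ZeroDispersion

/-- The Euclidean space `ℝ^N`. -/
abbrev Space (N : ℕ) : Type := EuclideanSpace ℝ (Fin N)

/-- The classical partial derivative `∂_j f (x)`. -/
def partialDeriv {N : ℕ} (j : Fin N) (f : Space N → ℝ) (x : Space N) : ℝ :=
  fderiv ℝ f x (EuclideanSpace.single j 1)

/-- The divergence `div v (x) = ∑ᵢ ∂ᵢ vᵢ (x)`. -/
def divergence {N : ℕ} (v : Space N → Space N) (x : Space N) : ℝ :=
  ∑ i, partialDeriv i (fun y => v y i) x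

/-- The real function `f` is square integrable, and the Bessel potential of order `s` of `f`
(as a tempered distribution) is the `L²` function `g`. Thus `f ∈ H^s`, and the `L²` norm of `g`
is the `H^s` norm of `f`. -/
def HasBesselPotential {N : ℕ} (s : ℝ) (f : Space N → ℝ)
    (g : Lp ℂ 2 (volume : Measure (Space N))) : Prop :=
  ∃ hf : MemLp (fun x => (f x : ℂ)) 2 (volume : Measure (Space N)),
    TemperedDistribution.besselPotential (Space N) ℂ s (hf.toLp (fun x => (f x : ℂ))) = g

/-- The vector field `v` belongs to the Sobolev space `H^s(ℝ^N)`. -/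
def MemHs {N : ℕ} (s : ℝ) (v : Space N → Space N) : Prop :=
  ∀ i, ∃ hf : MemLp (fun x => (v x i : ℂ)) 2 (volume : Measure (Space N)),
    TemperedDistribution.MemSobolev s 2
      (hf.toLp (fun x => (v x i : ℂ)) : TemperedDistribution (Space N) ℂ)

/-- The curve `t ↦ u t` belongs to `C([0, T); H^s(ℝ^N))`: the map `f ↦ (Bessel potential of f)`
is an isometry of `H^s` onto `L²`, so continuity in `H^s` is continuity of the Bessel potentials
in `L²`. -/
def ContinuousInHs {N : ℕ} (s T : ℝ) (u : ℝ → Space N → Space N) : Prop :=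
  ∀ i, ∃ w : ℝ → Lp ℂ 2 (volume : Measure (Space N)),
    ContinuousOn w (Ico 0 T) ∧
      ∀ t ∈ Ico 0 T, HasBesselPotential s (fun x => u t x i) (w t)

/-- `u` is a classical solution on the time interval `[0, T)`, in the class `C([0, T); H^s)`, of
`∂_t u + div (u ⊗ u) + ½ ∇|u|² = 0`, `u(·, 0) = u₀`. -/
structure IsClassicalSolution {N : ℕ} (s : ℝ) (u₀ : Space N → Space N) (T : ℝ)
    (u : ℝ → Space N → Space N) : Prop where
  pos : 0 < T
  continuousInHs : ContinuousInHs s T u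
  contDiffOn : ContDiffOn ℝ 1 (fun p : ℝ × Space N => u p.1 p.2) (Ico 0 T ×ˢ univ)
  initial : u 0 = u₀
  equation : ∀ t ∈ Ioo 0 T, ∀ (x : Space N) (i : Fin N),
    deriv (fun τ => u τ x i) t
      + ∑ j, partialDeriv j (fun y => u t y i * u t y j) x
      + (1 / 2) * partialDeriv i (fun y => ‖u t y‖ ^ 2) x = 0

/-- The maximal time of existence `T_* ∈ [0, ∞]` of the classical solution in `H^s` with initial
data `u₀`: the supremum of all `T` such that a classical solution exists on `[0, T)`. -/
def maximalTime {N : ℕ} (s : ℝ) (u₀ : Space N → Space N) : ℝ≥0∞ :=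
  ⨆ (T : ℝ) (_ : ∃ u, IsClassicalSolution s u₀ T u), ENNReal.ofReal T

end ZeroDispersion

end

open Filter Topology InnerProductSpace

noncomputable section

namespace ZeroDispersion

variable {N : ℕ}

/-! ### The trace of an endomorphism and the quadratic nonlinearity -/

/-! Where u vanishes, the equation for its Jacobian A closes: the derivative of A y is
`-nonlinearity A (A y)`. Taking the trace at the origin, d = div u(t, 0) satisfies d' = -(tr A² +
(tr A)² + tr AᵀA). Since tr A² + tr AᵀA = ½|A + Aᵀ|² ≥ 0 (`sq_trace_le`), this gives d' ≤ -d², and a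
negative d(0) cannot survive past time 1/|d(0)| (`le_inv_abs_of_deriv_le_neg_sq`).

It remains to see that the origin stays a zero of u. The field -u(t, -x) solves the same equations
with the same odd data, so uniqueness at the origin is enough. `eq_at_origin` obtains it from a
local energy estimate for C¹ solutions: the difference w of two solutions satisfies an energy
identity with flux ½|w|² u + ⟨w, u⟩ w, and a weight supported in a shrinking ball absorbs this flux.
Near the origin |u| ≤ L|x| + δ, so a ball shrinking exponentially outruns the flux, yet still
contains the origin at the final time if δ is small. The bound by δ is itself a smallness assumption
on u(t, 0), removed by a continuity argument in `apply_origin_eq_zero`. -/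

/-- The trace of an endomorphism of `ℝ^N` in the standard basis. -/
def trace (A : Space N →L[ℝ] Space N) : ℝ :=
  ∑ i, A (EuclideanSpace.single i 1) i

lemma continuous_trace : Continuous (trace : (Space N →L[ℝ] Space N) → ℝ) := by
  unfold trace
  fun_prop

lemma trace_add (A B : Space N →L[ℝ] Space N) : trace (A + B) = trace A + trace B := by
  simp [trace, Finset.sum_add_distrib]

lemma trace_sub (A B : Space N →L[ℝ] Space N) : trace (A - B) = trace A - trace B := by
  simp [trace, Finset.sum_sub_distrib]

lemma trace_smul (c : ℝ) (A : Space N →L[ℝ] Space N) : trace (c • A) = c * trace A := by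
  simp [trace, Finset.mul_sum]

lemma sum_smul_single (z : Space N) : ∑ i, z i • EuclideanSpace.single i (1 : ℝ) = z := by
  simpa using (EuclideanSpace.basisFun (Fin N) ℝ).sum_repr z

lemma trace_smulRight (l : Space N →L[ℝ] ℝ) (z : Space N) : trace (l.smulRight z) = l z := by
  conv_rhs => rw [← sum_smul_single z]
  simp [trace, mul_comm]

lemma abs_trace_le (A : Space N →L[ℝ] Space N) : |trace A| ≤ N * ‖A‖ := by
  calc |trace A| ≤ ∑ i : Fin N, |A (EuclideanSpace.single i 1) i| := Finset.abs_sum_le_sum_abs _ _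
    _ ≤ ∑ _i : Fin N, ‖A‖ := by
        refine Finset.sum_le_sum fun i _ => ?_
        calc |A (EuclideanSpace.single i 1) i| ≤ ‖A (EuclideanSpace.single i 1)‖ :=
              PiLp.norm_apply_le (A (EuclideanSpace.single i 1)) i
          _ ≤ ‖A‖ * ‖EuclideanSpace.single i (1 : ℝ)‖ := A.le_opNorm _
          _ = ‖A‖ := by simp
    _ = N * ‖A‖ := by simp

/-- The value of `div (u ⊗ u) + ½ ∇|u|²` at a point where `u` has value `z` and Jacobian `A`. -/
def nonlinearity (A : Space N →L[ℝ] Space N) (z : Space N) : Space N :=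
  A z + trace A • z + A.adjoint z

lemma continuous_nonlinearity :
    Continuous fun p : (Space N →L[ℝ] Space N) × Space N => nonlinearity p.1 p.2 := by
  unfold nonlinearity
  have h : Continuous fun p : (Space N →L[ℝ] Space N) × Space N =>
      (ContinuousLinearMap.adjoint p.1 : Space N →L[ℝ] Space N) :=
    (ContinuousLinearMap.adjoint (𝕜 := ℝ) (E := Space N) (F := Space N)).continuous.comp
      continuous_fst
  exact ((continuous_fst.clm_apply continuous_snd).add
    ((continuous_trace.comp continuous_fst).smul continuous_snd)).add (h.clm_apply continuous_snd)

/-- Linearity in the state with the Jacobian held fixed serves twice: c = -1 gives the reflection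
symmetry, and c = h⁻¹ gives the difference quotients at the origin. -/
lemma nonlinearity_smul (A : Space N →L[ℝ] Space N) (c : ℝ) (z : Space N) :
    nonlinearity A (c • z) = c • nonlinearity A z := by
  simp [nonlinearity, smul_add, smul_comm c]

lemma norm_nonlinearity_le (A : Space N →L[ℝ] Space N) (z : Space N) :
    ‖nonlinearity A z‖ ≤ (N + 2) * ‖A‖ * ‖z‖ := by
  have h1 := A.le_opNorm z
  have h2 := (ContinuousLinearMap.adjoint A).le_opNorm z
  rw [LinearIsometryEquiv.norm_map] at h2
  have h3 : ‖trace A • z‖ ≤ N * ‖A‖ * ‖z‖ := by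
    rw [norm_smul]
    exact mul_le_mul_of_nonneg_right (abs_trace_le A) (norm_nonneg _)
  calc _ ≤ ‖A z‖ + ‖trace A • z‖ + ‖A.adjoint z‖ := norm_add₃_le
    _ ≤ _ := by linarith

/-- The equations are of symmetric hyperbolic type: up to terms of order zero, the difference of
the nonlinearities, paired with the difference of the states, is a divergence. -/
lemma inner_nonlinearity_sub (A B : Space N →L[ℝ] Space N) (y z : Space N) :
    ⟪y - z, nonlinearity A y - nonlinearity B z⟫_ℝ =
      ⟪y - z, (A - B) y⟫_ℝ + trace (A - B) * ⟪y - z, y⟫_ℝ + ⟪(A - B) (y - z), y⟫_ℝ +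
        ⟪y - z, nonlinearity B (y - z)⟫_ℝ := by
  simp only [nonlinearity, trace_sub, inner_sub_left, inner_sub_right, inner_add_right,
    inner_smul_right, ContinuousLinearMap.adjoint_inner_right, sub_apply,
    map_sub]
  ring

/-- The integral of the divergence of a compactly supported `C¹` vector field vanishes. -/
lemma integral_trace_fderiv_eq_zero {X : Space N → Space N} (hX : ContDiff ℝ 1 X)
    (hs : HasCompactSupport X) :
    Integrable (fun x => trace (fderiv ℝ X x)) ∧ ∫ x, trace (fderiv ℝ X x) = 0 := by
  have hc : Continuous (fderiv ℝ X) := hX.continuous_fderiv one_ne_zero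
  have hsc : ∀ i : Fin N,
      HasCompactSupport fun x => fderiv ℝ X x (EuclideanSpace.single i 1) := fun i =>
    (hs.fderiv ℝ).comp_left (g := fun A : Space N →L[ℝ] Space N => A (EuclideanSpace.single i 1))
      (by simp)
  have hint : ∀ i : Fin N, Integrable fun x => fderiv ℝ X x (EuclideanSpace.single i 1) := fun i =>
    (hc.clm_apply continuous_const).integrable_of_hasCompactSupport (hsc i)
  have hzero : ∀ i : Fin N, ∫ x, fderiv ℝ X x (EuclideanSpace.single i 1) = 0 := fun i => by
    -- Integration by parts against the constant function 1.
    have := integral_smul_fderiv_eq_neg_fderiv_smul_of_integrable (μ := (volume : Measure (Space N)))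
      (f := fun _ => (1 : ℝ)) (g := X) (v := EuclideanSpace.single i 1) (by simp)
      (by simpa using hint i) (by simpa using hX.continuous.integrable_of_hasCompactSupport hs)
      (fun _ _ => differentiableAt_const _)
      (fun x _ => (hX.differentiable one_ne_zero) x)
    simpa using this
  have hint' : ∀ i : Fin N, Integrable fun x => fderiv ℝ X x (EuclideanSpace.single i 1) i :=
    fun i => (EuclideanSpace.proj (𝕜 := ℝ) i).integrable_comp (hint i)
  refine ⟨integrable_finsetSum _ fun i _ => hint' i, ?_⟩
  unfold trace
  rw [integral_finsetSum _ fun i _ => hint' i]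
  refine Finset.sum_eq_zero fun i _ => ?_
  have := (EuclideanSpace.proj (𝕜 := ℝ) i).integral_comp_comm (hint i)
  rw [hzero i, map_zero] at this
  exact this

/-! ### Regular solutions -/

/-- `u` is a `C¹` solution of `∂_t u + div (u ⊗ u) + ½ ∇|u|² = 0` on `[0, T)`. -/
structure IsRegularSolution (T : ℝ) (u : ℝ → Space N → Space N) : Prop where
  contDiffOn : ContDiffOn ℝ 1 (fun p : ℝ × Space N => u p.1 p.2) (Ico 0 T ×ˢ univ)
  hasDerivAt : ∀ t ∈ Ioo 0 T, ∀ x,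
    HasDerivAt (fun τ => u τ x) (-nonlinearity (fderiv ℝ (u t) x) (u t x)) t

namespace IsRegularSolution

variable {T : ℝ} {u : ℝ → Space N → Space N}

lemma continuousOn (hu : IsRegularSolution T u) :
    ContinuousOn (fun p : ℝ × Space N => u p.1 p.2) (Ico 0 T ×ˢ univ) :=
  hu.contDiffOn.continuousOn

lemma contDiff (hu : IsRegularSolution T u) {t : ℝ} (ht : t ∈ Ico 0 T) : ContDiff ℝ 1 (u t) := by
  rw [← contDiffOn_univ]
  exact hu.contDiffOn.comp (f := fun x : Space N => (t, x)) (by fun_prop) fun x _ => ⟨ht, trivial⟩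

lemma hasFDerivAt (hu : IsRegularSolution T u) {t : ℝ} (ht : t ∈ Ico 0 T) (x : Space N) :
    HasFDerivAt (u t) (fderiv ℝ (u t) x) x :=
  ((hu.contDiff ht).differentiable one_ne_zero x).hasFDerivAt

/-- The spatial Jacobian is the joint derivative restricted to directions (0, y). The derivative
within [0, T) × ℝ^N is used so that t = 0 is covered. -/
lemma continuousOn_fderiv (hu : IsRegularSolution T u) :
    ContinuousOn (fun p : ℝ × Space N => fderiv ℝ (u p.1) p.2) (Ico 0 T ×ˢ univ) := by
  have huniq : UniqueDiffOn ℝ (Ico 0 T ×ˢ (univ : Set (Space N))) :=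
    (uniqueDiffOn_Ico 0 T).prod uniqueDiffOn_univ
  have hc := hu.contDiffOn.continuousOn_fderivWithin huniq le_rfl
  have : ContinuousOn (fun p : ℝ × Space N =>
      (fderivWithin ℝ (fun p : ℝ × Space N => u p.1 p.2) (Ico 0 T ×ˢ univ) p).comp
        (ContinuousLinearMap.inr ℝ ℝ (Space N))) (Ico 0 T ×ˢ univ) :=
    hc.clm_comp continuousOn_const
  refine this.congr fun p hp => ?_
  have h1 := ((hu.contDiffOn.differentiableOn one_ne_zero) p hp).hasFDerivWithinAt
  have h2 : HasFDerivWithinAt (fun x : Space N => (p.1, x))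
      (ContinuousLinearMap.inr ℝ ℝ (Space N)) univ p.2 :=
    (hasFDerivAt_prodMk_right p.1 p.2).hasFDerivWithinAt
  have h3 := HasFDerivWithinAt.comp p.2 (f := fun x : Space N => (p.1, x)) h1 h2
    fun x _ => ⟨hp.1, trivial⟩
  exact (hasFDerivWithinAt_univ.1 h3).fderiv

lemma continuousOn_nonlinearity (hu : IsRegularSolution T u) :
    ContinuousOn (fun p : ℝ × Space N => nonlinearity (fderiv ℝ (u p.1) p.2) (u p.1 p.2))
      (Ico 0 T ×ˢ univ) :=
  Continuous.comp_continuousOn (f := fun p : ℝ × Space N => (fderiv ℝ (u p.1) p.2, u p.1 p.2))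
    continuous_nonlinearity (hu.continuousOn_fderiv.prodMk hu.continuousOn)

/-- The inner and outer signs cancel. -/
lemma fderiv_reflect (hu : IsRegularSolution T u) {t : ℝ} (ht : t ∈ Ico 0 T) (x : Space N) :
    fderiv ℝ (fun x => -u t (-x)) x = fderiv ℝ (u t) (-x) := by
  have h1 := (hu.hasFDerivAt ht (-x)).comp x (hasFDerivAt_id x).neg
  have h2 : HasFDerivAt (fun x => -u t (-x)) (fderiv ℝ (u t) (-x)) x :=
    h1.neg.congr_fderiv (by ext1 y; simp)
  exact h2.fderiv

/-- The equations are invariant under the reflection `u(t, x) ↦ -u(t, -x)`. -/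
lemma reflect (hu : IsRegularSolution T u) : IsRegularSolution T fun t x => -u t (-x) where
  contDiffOn :=
    (hu.contDiffOn.comp (f := fun p : ℝ × Space N => (p.1, -p.2)) (by fun_prop)
      fun p hp => ⟨hp.1, trivial⟩).neg
  hasDerivAt t ht x := by
    have h := (hu.hasDerivAt t ht (-x)).neg
    rw [hu.fderiv_reflect (Ioo_subset_Ico_self ht), ← neg_one_smul ℝ (u t (-x)),
      nonlinearity_smul, neg_one_smul]
    exact h

end IsRegularSolution

/-! ### A weight decreasing along the characteristics -/

lemma deriv_expNegInvGlue_nonneg (s : ℝ) : 0 ≤ deriv expNegInvGlue s :=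
  expNegInvGlue.monotone.deriv_nonneg

lemma deriv_expNegInvGlue_of_nonpos {s : ℝ} (hs : s ≤ 0) : deriv expNegInvGlue s = 0 := by
  -- A zero of a nonnegative function is a minimum; this covers s = 0 as well.
  refine IsLocalMin.deriv_eq_zero (Eventually.of_forall fun y => ?_)
  rw [expNegInvGlue.zero_of_nonpos hs]
  exact expNegInvGlue.nonneg y

lemma continuous_deriv_expNegInvGlue : Continuous (deriv expNegInvGlue) :=
  (expNegInvGlue.contDiff (n := 1)).continuous_deriv le_rfl

lemma hasDerivAt_expNegInvGlue (s : ℝ) :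
    HasDerivAt expNegInvGlue (deriv expNegInvGlue s) s :=
  ((expNegInvGlue.contDiff (n := 1)).differentiable one_ne_zero s).hasDerivAt

/-- The argument of the weight. It is negative outside the unit ball if `0 ≤ c * t`. -/
def weightArg (c δ t : ℝ) (x : Space N) : ℝ :=
  1 - Real.exp (2 * c * t) * (‖x‖ ^ 2 + δ ^ 2)

/-- A smooth weight supported in the region `exp (2ct) (|x|² + δ²) ≤ 1`, which shrinks at a rate
proportional to the distance to the origin. -/
def weight (c δ t : ℝ) (x : Space N) : ℝ := expNegInvGlue (weightArg c δ t x)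

/-- The time derivative of the weight. -/
def weightTimeDeriv (c δ t : ℝ) (x : Space N) : ℝ :=
  deriv expNegInvGlue (weightArg c δ t x) *
    -(2 * c * Real.exp (2 * c * t) * (‖x‖ ^ 2 + δ ^ 2))

lemma weightArg_nonpos {c δ t : ℝ} {x : Space N} (hct : 0 ≤ c * t) (hx : 1 ≤ ‖x‖) :
    weightArg c δ t x ≤ 0 := by
  have h1 : 1 ≤ Real.exp (2 * c * t) := Real.one_le_exp (by linarith)
  have h2 : 1 ≤ ‖x‖ ^ 2 + δ ^ 2 := by nlinarith [sq_nonneg δ]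
  unfold weightArg
  nlinarith

lemma weight_eq_zero {c δ t : ℝ} {x : Space N} (hct : 0 ≤ c * t) (hx : 1 ≤ ‖x‖) :
    weight c δ t x = 0 :=
  expNegInvGlue.zero_of_nonpos (weightArg_nonpos hct hx)

lemma weightTimeDeriv_eq_zero {c δ t : ℝ} {x : Space N} (hct : 0 ≤ c * t) (hx : 1 ≤ ‖x‖) :
    weightTimeDeriv c δ t x = 0 := by
  rw [weightTimeDeriv, deriv_expNegInvGlue_of_nonpos (weightArg_nonpos hct hx), zero_mul]

lemma weight_nonneg (c δ t : ℝ) (x : Space N) : 0 ≤ weight c δ t x := expNegInvGlue.nonneg _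

lemma continuous_weightArg (c δ : ℝ) :
    Continuous fun p : ℝ × Space N => weightArg c δ p.1 p.2 := by
  unfold weightArg
  fun_prop

lemma continuous_weight (c δ : ℝ) : Continuous fun p : ℝ × Space N => weight c δ p.1 p.2 :=
  (expNegInvGlue.contDiff (n := 1)).continuous.comp (continuous_weightArg c δ)

lemma continuous_weightTimeDeriv (c δ : ℝ) :
    Continuous fun p : ℝ × Space N => weightTimeDeriv c δ p.1 p.2 :=
  (continuous_deriv_expNegInvGlue.comp (continuous_weightArg c δ)).mul (by fun_prop)

lemma contDiff_weight (c δ t : ℝ) : ContDiff ℝ 1 (weight c δ t : Space N → ℝ) := by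
  refine (expNegInvGlue.contDiff (n := 1)).comp ?_
  unfold weightArg
  exact contDiff_const.sub (contDiff_const.mul ((contDiff_norm_sq ℝ).add contDiff_const))

lemma hasDerivAt_weight (c δ t : ℝ) (x : Space N) :
    HasDerivAt (fun τ => weight c δ τ x) (weightTimeDeriv c δ t x) t := by
  have h1 : HasDerivAt (fun τ => weightArg c δ τ x)
      (-(2 * c * Real.exp (2 * c * t) * (‖x‖ ^ 2 + δ ^ 2))) t := by
    unfold weightArg
    have := ((((hasDerivAt_id t).const_mul (2 * c)).exp.mul_const
      (‖x‖ ^ 2 + δ ^ 2)).const_sub 1)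
    refine this.congr_deriv ?_
    simp only [id]
    ring
  exact (hasDerivAt_expNegInvGlue _).comp t h1

lemma fderiv_weight (c δ t : ℝ) (x y : Space N) :
    fderiv ℝ (weight c δ t) x y =
      deriv expNegInvGlue (weightArg c δ t x) * -(2 * Real.exp (2 * c * t) * ⟪x, y⟫_ℝ) := by
  have h1 : HasFDerivAt (weightArg c δ t)
      (-(Real.exp (2 * c * t) • (2 • innerSL ℝ x))) x := by
    unfold weightArg
    exact (((hasStrictFDerivAt_norm_sq x).hasFDerivAt.add_const _).const_mul _).const_sub 1
  have h2 := (hasDerivAt_expNegInvGlue (weightArg c δ t x)).comp_hasFDerivAt x h1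
  have h3 : fderiv ℝ (weight c δ t) x = _ := h2.fderiv
  rw [h3]
  simp only [neg_apply, smul_apply, innerSL_apply_apply, smul_eq_mul, nsmul_eq_mul]
  push_cast
  ring

/-- The weight decreases faster than the characteristic speeds transport it. -/
lemma weightTimeDeriv_add_le {c δ t L : ℝ} {x y : Space N} (hL : 0 ≤ L)
    (hc : c = 3 * (L + 1)) (hy : ‖y‖ ≤ L * ‖x‖ + δ) (w : Space N) :
    weightTimeDeriv c δ t x * ‖w‖ ^ 2 +
      2 * fderiv ℝ (weight c δ t) x ((1 / 2 * ‖w‖ ^ 2) • y + ⟪w, y⟫_ℝ • w) ≤ 0 := by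
  rw [fderiv_weight, weightTimeDeriv]
  have hψ := deriv_expNegInvGlue_nonneg (weightArg c δ t x)
  have he := Real.exp_pos (2 * c * t)
  generalize deriv expNegInvGlue (weightArg c δ t x) = ψ at *
  generalize Real.exp (2 * c * t) = e at *
  -- By Cauchy–Schwarz the flux has size at most 3/2 · |y| |w|².
  have hb : -⟪x, (1 / 2 * ‖w‖ ^ 2) • y + ⟪w, y⟫_ℝ • w⟫_ℝ ≤ 3 / 2 * (‖x‖ * ‖y‖) * ‖w‖ ^ 2 := by
    rw [inner_add_right, inner_smul_right, inner_smul_right]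
    have h1 : -⟪x, y⟫_ℝ ≤ ‖x‖ * ‖y‖ := (neg_le_abs _).trans (abs_real_inner_le_norm x y)
    have h2 : -(⟪w, y⟫_ℝ * ⟪x, w⟫_ℝ) ≤ (‖w‖ * ‖y‖) * (‖x‖ * ‖w‖) := by
      refine (neg_le_abs _).trans ?_
      rw [abs_mul]
      exact mul_le_mul (abs_real_inner_le_norm w y) (abs_real_inner_le_norm x w) (abs_nonneg _)
        (by positivity)
    nlinarith [mul_le_mul_of_nonneg_left h1 (sq_nonneg ‖w‖)]
  -- Young's inequality: |x| δ ≤ ½(|x|² + δ²).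
  have hxy : ‖x‖ * ‖y‖ ≤ (L + 1) * (‖x‖ ^ 2 + δ ^ 2) := by
    have h1 : ‖x‖ * ‖y‖ ≤ ‖x‖ * (L * ‖x‖ + δ) := mul_le_mul_of_nonneg_left hy (norm_nonneg x)
    nlinarith [sq_nonneg (‖x‖ - δ), mul_nonneg hL (sq_nonneg δ), sq_nonneg ‖x‖, sq_nonneg δ]
  -- The choice c = 3(L + 1) is exactly what turns 3/2 · (L + 1) into c/2.
  have hfin : -⟪x, (1 / 2 * ‖w‖ ^ 2) • y + ⟪w, y⟫_ℝ • w⟫_ℝ ≤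
      c / 2 * (‖x‖ ^ 2 + δ ^ 2) * ‖w‖ ^ 2 := by
    refine hb.trans ?_
    rw [hc]
    nlinarith [mul_le_mul_of_nonneg_right hxy (sq_nonneg ‖w‖)]
  have := mul_le_mul_of_nonneg_left hfin (mul_nonneg hψ he.le)
  nlinarith

/-! ### The local energy estimate -/

/-- The energy flux `½ |w|² y + ⟨w, y⟩ w`, weighted by `φ`. -/
def energyFlux (φ : Space N → ℝ) (y w : Space N → Space N) (x : Space N) : Space N :=
  φ x • ((1 / 2 * ‖w x‖ ^ 2) • y x + ⟪w x, y x⟫_ℝ • w x)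

lemma contDiff_energyFlux {φ : Space N → ℝ} {y w : Space N → Space N} (hφ : ContDiff ℝ 1 φ)
    (hy : ContDiff ℝ 1 y) (hw : ContDiff ℝ 1 w) : ContDiff ℝ 1 (energyFlux φ y w) :=
  hφ.smul (((contDiff_const.mul (hw.norm_sq ℝ)).smul hy).add ((hw.inner ℝ hy).smul hw))

/-- The product rule. The first three terms in the bracket are those of `inner_nonlinearity_sub`
with W = A - B; the last two contain no derivative of w and are of order zero. -/
lemma trace_fderiv_energyFlux {φ : Space N → ℝ} {y w : Space N → Space N} {x : Space N}
    {Y W : Space N →L[ℝ] Space N} (hφ : DifferentiableAt ℝ φ x)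
    (hy : HasFDerivAt y Y x) (hw : HasFDerivAt w W x) :
    trace (fderiv ℝ (energyFlux φ y w) x) =
      fderiv ℝ φ x ((1 / 2 * ‖w x‖ ^ 2) • y x + ⟪w x, y x⟫_ℝ • w x) +
      φ x * (⟪w x, W (y x)⟫_ℝ + trace W * ⟪w x, y x⟫_ℝ + ⟪W (w x), y x⟫_ℝ +
        1 / 2 * ‖w x‖ ^ 2 * trace Y + ⟪w x, Y (w x)⟫_ℝ) := by
  have h1 := (hw.norm_sq.const_mul (1 / 2)).smul hy
  have h2 := (hw.inner ℝ hy).smul hw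
  have h3 := hφ.hasFDerivAt.smul (h1.add h2)
  have h4 : fderiv ℝ (energyFlux φ y w) x = _ := h3.fderiv
  rw [h4]
  simp only [trace_add, trace_smul, trace_smulRight]
  simp [fderivInnerCLM_apply]
  ring

lemma integrable_of_continuous_of_eq_zero_off_ball {f : Space N → ℝ} {R : ℝ} (hf : Continuous f)
    (hs : ∀ x ∉ Metric.closedBall 0 R, f x = 0) : Integrable f :=
  hf.integrable_of_hasCompactSupport
    (HasCompactSupport.intro (isCompact_closedBall (0 : Space N) R) hs)

/-- Differentiation under the integral sign for functions supported in a fixed ball. -/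
lemma hasDerivAt_integral_of_eq_zero_off_ball {F F' : ℝ → Space N → ℝ} {a b R : ℝ}
    (hF : ContinuousOn (fun p : ℝ × Space N => F p.1 p.2) (Ioo a b ×ˢ univ))
    (hF' : ContinuousOn (fun p : ℝ × Space N => F' p.1 p.2) (Ioo a b ×ˢ univ))
    (hs : ∀ t ∈ Ioo a b, ∀ x ∉ Metric.closedBall 0 R, F t x = 0)
    (hs' : ∀ t ∈ Ioo a b, ∀ x ∉ Metric.closedBall 0 R, F' t x = 0)
    (hd : ∀ t ∈ Ioo a b, ∀ x, HasDerivAt (fun τ => F τ x) (F' t x) t) {t : ℝ}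
    (ht : t ∈ Ioo a b) :
    Integrable (F' t) ∧ HasDerivAt (fun τ => ∫ x, F τ x) (∫ x, F' t x) t := by
  have hslice : ∀ {G : ℝ → Space N → ℝ},
      ContinuousOn (fun p : ℝ × Space N => G p.1 p.2) (Ioo a b ×ˢ univ) →
      ∀ τ ∈ Ioo a b, Continuous (G τ) := fun hG τ hτ => by
    rw [← continuousOn_univ]
    exact hG.comp (f := fun x : Space N => (τ, x)) (by fun_prop) fun x _ => ⟨hτ, trivial⟩
  obtain ⟨ε, hε, hball⟩ := Metric.nhds_basis_closedBall.mem_iff.1 (isOpen_Ioo.mem_nhds ht)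
  -- Compactness in time and space makes a constant on the ball a dominating function.
  obtain ⟨C, hC⟩ := ((isCompact_closedBall t ε).prod
    (isCompact_closedBall (0 : Space N) R)).exists_bound_of_continuousOn
    (hF'.mono (prod_mono hball (subset_univ _)))
  refine hasDerivAt_integral_of_dominated_loc_of_deriv_le
    (bound := (Metric.closedBall (0 : Space N) R).indicator fun _ => C)
    (Metric.closedBall_mem_nhds t hε) ?_
    (integrable_of_continuous_of_eq_zero_off_ball (hslice hF t ht) (hs t ht))
    (hslice hF' t ht).aestronglyMeasurable ?_ ?_ ?_
  · filter_upwards [isOpen_Ioo.mem_nhds ht] with τ hτ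
    exact (hslice hF τ hτ).aestronglyMeasurable
  · refine Eventually.of_forall fun x τ hτ => ?_
    by_cases hx : x ∈ Metric.closedBall (0 : Space N) R
    · rw [indicator_of_mem hx]
      exact hC (τ, x) ⟨hτ, hx⟩
    · rw [indicator_of_notMem hx, hs' τ (hball hτ) x hx, norm_zero]
  · exact (integrable_indicator_iff measurableSet_closedBall).2
      (integrableOn_const (isCompact_closedBall (0 : Space N) R).measure_ne_top)
  · exact Eventually.of_forall fun x τ hτ => hd τ (hball hτ) x

/-- A nonnegative function with `E' ≤ C E` that vanishes at the left endpoint vanishes. -/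
lemma eq_zero_of_deriv_le_mul {E E' : ℝ → ℝ} {C b : ℝ} (hc : ContinuousOn E (Icc 0 b))
    (hd : ∀ t ∈ Ioo 0 b, HasDerivAt E (E' t) t) (hle : ∀ t ∈ Ioo 0 b, E' t ≤ C * E t)
    (hnonneg : ∀ t ∈ Icc 0 b, 0 ≤ E t) (h0 : E 0 = 0) {t : ℝ} (ht : t ∈ Icc 0 b) : E t = 0 := by
  -- Grönwall's inequality by an integrating factor.
  have hanti : AntitoneOn (fun τ => Real.exp (-C * τ) * E τ) (Icc 0 b) := by
    refine antitoneOn_of_hasDerivWithinAt_nonpos (convex_Icc 0 b)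
      (f' := fun τ => Real.exp (-C * τ) * (-C * 1) * E τ + Real.exp (-C * τ) * E' τ)
      ((by fun_prop : Continuous fun τ => Real.exp (-C * τ)).continuousOn.mul hc) ?_ ?_
    · intro τ hτ
      rw [interior_Icc] at hτ
      exact ((((hasDerivAt_id τ).const_mul (-C)).exp).mul (hd τ hτ)).hasDerivWithinAt
    · intro τ hτ
      rw [interior_Icc] at hτ
      have := mul_le_mul_of_nonneg_left (hle τ hτ) (Real.exp_pos (-C * τ)).le
      linarith
  have h1 := hanti (left_mem_Icc.2 (ht.1.trans ht.2)) ht ht.1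
  simp only [h0, mul_zero] at h1
  have h2 := hnonneg t ht
  have h3 := Real.exp_pos (-C * t)
  by_contra hne
  exact absurd h1 (not_le.2 (mul_pos h3 (lt_of_le_of_ne h2 (Ne.symm hne))))

section Energy

variable {T b L c δ : ℝ} {u v : ℝ → Space N → Space N}

/-- The weighted energy density of the difference of two vector fields. -/
def energyDensity (c δ : ℝ) (u v : ℝ → Space N → Space N) (t : ℝ) (x : Space N) : ℝ :=
  weight c δ t x * ‖u t x - v t x‖ ^ 2

/-- The time derivative of the energy density along two solutions. -/
def energyDensityDeriv (c δ : ℝ) (u v : ℝ → Space N → Space N) (t : ℝ) (x : Space N) : ℝ :=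
  weightTimeDeriv c δ t x * ‖u t x - v t x‖ ^ 2 -
    2 * weight c δ t x * ⟪u t x - v t x, nonlinearity (fderiv ℝ (u t) x) (u t x) -
      nonlinearity (fderiv ℝ (v t) x) (v t x)⟫_ℝ

lemma continuousOn_energyDensity (hu : IsRegularSolution T u) (hv : IsRegularSolution T v) :
    ContinuousOn (fun p : ℝ × Space N => energyDensity c δ u v p.1 p.2) (Ico 0 T ×ˢ univ) :=
  (continuous_weight c δ).continuousOn.mul ((hu.continuousOn.sub hv.continuousOn).norm.pow 2)

lemma continuousOn_energyDensityDeriv (hu : IsRegularSolution T u)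
    (hv : IsRegularSolution T v) :
    ContinuousOn (fun p : ℝ × Space N => energyDensityDeriv c δ u v p.1 p.2)
      (Ico 0 T ×ˢ univ) := by
  have hw := hu.continuousOn.sub hv.continuousOn
  have hn := hu.continuousOn_nonlinearity.sub hv.continuousOn_nonlinearity
  exact ((continuous_weightTimeDeriv c δ).continuousOn.mul (hw.norm.pow 2)).sub
    ((continuousOn_const.mul (continuous_weight c δ).continuousOn).mul (hw.inner hn))

lemma hasDerivAt_energyDensity (hu : IsRegularSolution T u) (hv : IsRegularSolution T v)
    {t : ℝ} (ht : t ∈ Ioo 0 T) (x : Space N) :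
    HasDerivAt (fun τ => energyDensity c δ u v τ x) (energyDensityDeriv c δ u v t x) t := by
  have h := (hasDerivAt_weight c δ t x).mul
    ((hu.hasDerivAt t ht x).sub (hv.hasDerivAt t ht x)).norm_sq
  refine h.congr_deriv ?_
  simp only [energyDensityDeriv, Pi.sub_apply, inner_sub_right, inner_neg_right]
  ring

lemma energyDensity_eq_zero {t : ℝ} {x : Space N} (hct : 0 ≤ c * t) (hx : 1 ≤ ‖x‖) :
    energyDensity c δ u v t x = 0 := by
  rw [energyDensity, weight_eq_zero hct hx, zero_mul]

lemma energyDensityDeriv_eq_zero {t : ℝ} {x : Space N} (hct : 0 ≤ c * t) (hx : 1 ≤ ‖x‖) :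
    energyDensityDeriv c δ u v t x = 0 := by
  rw [energyDensityDeriv, weight_eq_zero hct hx, weightTimeDeriv_eq_zero hct hx]
  ring

/-- The pointwise energy inequality: up to a divergence, the energy density grows at most
exponentially. -/
lemma energyDensityDeriv_add_trace_le (hu : IsRegularSolution T u) (hv : IsRegularSolution T v)
    (hL : 0 ≤ L) (hc : c = 3 * (L + 1)) {t : ℝ} (ht : t ∈ Ico 0 T) {x : Space N}
    (hux : ‖u t x‖ ≤ L * ‖x‖ + δ) (hDu : ‖fderiv ℝ (u t) x‖ ≤ L)
    (hDv : ‖fderiv ℝ (v t) x‖ ≤ L) :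
    energyDensityDeriv c δ u v t x +
      2 * trace (fderiv ℝ (energyFlux (weight c δ t) (u t) fun y => u t y - v t y) x) ≤
      (3 * N + 6) * L * energyDensity c δ u v t x := by
  rw [trace_fderiv_energyFlux (w := fun y => u t y - v t y)
    ((contDiff_weight c δ t).differentiable one_ne_zero x) (hu.hasFDerivAt ht x)
    ((hu.hasFDerivAt ht x).sub (hv.hasFDerivAt ht x)),
    energyDensityDeriv, energyDensity, inner_nonlinearity_sub]
  have hφ := weight_nonneg c δ t x
  have hflux := weightTimeDeriv_add_le (t := t) (x := x) hL hc hux (u t x - v t x)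
  generalize fderiv ℝ (u t) x = A at *
  generalize fderiv ℝ (v t) x = B at *
  generalize u t x - v t x = w at *
  generalize weight c δ t x = φ at *
  have h1 : trace A ≤ N * L :=
    (le_abs_self _).trans ((abs_trace_le A).trans (by gcongr))
  have h2 : ⟪w, A w⟫_ℝ ≤ L * ‖w‖ ^ 2 := by
    calc ⟪w, A w⟫_ℝ ≤ ‖w‖ * ‖A w‖ := real_inner_le_norm _ _
      _ ≤ ‖w‖ * (L * ‖w‖) := by gcongr; exact A.le_of_opNorm_le hDu w
      _ = L * ‖w‖ ^ 2 := by ring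
  have h3 : -⟪w, nonlinearity B w⟫_ℝ ≤ (N + 2) * L * ‖w‖ ^ 2 := by
    calc -⟪w, nonlinearity B w⟫_ℝ ≤ ‖w‖ * ‖nonlinearity B w‖ :=
          (neg_le_abs _).trans (abs_real_inner_le_norm _ _)
      _ ≤ ‖w‖ * ((N + 2) * L * ‖w‖) := by
          gcongr
          exact (norm_nonlinearity_le B w).trans (by gcongr)
      _ = (N + 2) * L * ‖w‖ ^ 2 := by ring
  have h4 : ‖w‖ ^ 2 * trace A ≤ ‖w‖ ^ 2 * (N * L) := by gcongr
  -- The constant is N from the trace, 2 from A, and 2(N + 2) from the nonlinearity.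
  have h5 : ‖w‖ ^ 2 * trace A + 2 * ⟪w, A w⟫_ℝ - 2 * ⟪w, nonlinearity B w⟫_ℝ ≤
      (3 * N + 6) * L * ‖w‖ ^ 2 := by linarith
  have h6 := mul_le_mul_of_nonneg_left h5 hφ
  linarith

/-- The flux is compactly supported, so its divergence integrates to zero. Everything vanishes
outside the unit ball, which is why bounds are needed only inside it. -/
lemma integral_energyDensityDeriv_le (hu : IsRegularSolution T u) (hv : IsRegularSolution T v)
    (hL : 0 ≤ L) (hc : c = 3 * (L + 1)) {t : ℝ} (ht : t ∈ Ico 0 T)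
    (hux : ∀ x, ‖x‖ ≤ 1 → ‖u t x‖ ≤ L * ‖x‖ + δ)
    (hDu : ∀ x, ‖x‖ ≤ 1 → ‖fderiv ℝ (u t) x‖ ≤ L)
    (hDv : ∀ x, ‖x‖ ≤ 1 → ‖fderiv ℝ (v t) x‖ ≤ L)
    (hint : Integrable (energyDensityDeriv c δ u v t))
    (hint' : Integrable (energyDensity c δ u v t)) :
    ∫ x, energyDensityDeriv c δ u v t x ≤
      (3 * N + 6) * L * ∫ x, energyDensity c δ u v t x := by
  have hct : 0 ≤ c * t := mul_nonneg (by rw [hc]; positivity) ht.1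
  set X := energyFlux (weight c δ t) (u t) fun y => u t y - v t y with hX
  have hXsupp : ∀ x : Space N, 1 ≤ ‖x‖ → X x = 0 := fun x hx => by
    simp [hX, energyFlux, weight_eq_zero hct hx]
  obtain ⟨hdivint, hdiv⟩ := integral_trace_fderiv_eq_zero (X := X)
    (contDiff_energyFlux (contDiff_weight c δ t) (hu.contDiff ht)
      ((hu.contDiff ht).sub (hv.contDiff ht)))
    (HasCompactSupport.intro (isCompact_closedBall (0 : Space N) 1) fun x hx =>
      hXsupp x (by simpa using (not_le.1 (by simpa using hx : ¬ ‖x‖ ≤ 1)).le))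
  have hpt : ∀ x, energyDensityDeriv c δ u v t x + 2 * trace (fderiv ℝ X x) ≤
      (3 * N + 6) * L * energyDensity c δ u v t x := by
    intro x
    rcases le_or_gt ‖x‖ 1 with hx | hx
    · exact energyDensityDeriv_add_trace_le hu hv hL hc ht (hux x hx) (hDu x hx) (hDv x hx)
    · have hev : X =ᶠ[𝓝 x] fun _ => 0 := by
        filter_upwards [(isOpen_lt continuous_const continuous_norm).mem_nhds hx] with y hy
        exact hXsupp y (le_of_lt hy)
      rw [energyDensityDeriv_eq_zero hct hx.le, energyDensity_eq_zero hct hx.le, hev.fderiv_eq]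
      simp [trace]
  have := integral_mono (hint.add (hdivint.const_mul 2)) (hint'.const_mul _) hpt
  simp only [Pi.add_apply] at this
  rwa [integral_add hint (hdivint.const_mul 2), integral_const_mul, hdiv, mul_zero, add_zero,
    integral_const_mul] at this

/-- Two solutions with the same data agree at the origin as long as one of them is small there,
provided the Jacobians are bounded in the unit ball. -/
lemma eq_at_origin (hu : IsRegularSolution T u) (hv : IsRegularSolution T v) (h0 : u 0 = v 0)
    (hb : b ∈ Ico 0 T) (hL : 0 ≤ L) (hδ : Real.exp (2 * (3 * (L + 1)) * b) * δ ^ 2 < 1)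
    (hux : ∀ t ∈ Ioo 0 b, ∀ x, ‖x‖ ≤ 1 → ‖u t x‖ ≤ L * ‖x‖ + δ)
    (hDu : ∀ t ∈ Icc 0 b, ∀ x, ‖x‖ ≤ 1 → ‖fderiv ℝ (u t) x‖ ≤ L)
    (hDv : ∀ t ∈ Icc 0 b, ∀ x, ‖x‖ ≤ 1 → ‖fderiv ℝ (v t) x‖ ≤ L) {t : ℝ} (ht : t ∈ Icc 0 b) :
    u t 0 = v t 0 := by
  obtain ⟨c, hc⟩ : ∃ c, c = 3 * (L + 1) := ⟨_, rfl⟩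
  have hc0 : 0 ≤ c := by rw [hc]; positivity
  have hsub : Icc 0 b ⊆ Ico 0 T := fun τ hτ => ⟨hτ.1, hτ.2.trans_lt hb.2⟩
  have hsub' : Ioo 0 b ⊆ Ico 0 T := Ioo_subset_Icc_self.trans hsub
  have hnorm : ∀ x ∉ Metric.closedBall (0 : Space N) 1, 1 ≤ ‖x‖ := fun x hx =>
    (not_le.1 (by simpa using hx : ¬ ‖x‖ ≤ 1)).le
  have hsupp : ∀ τ ∈ Icc 0 b, ∀ x ∉ Metric.closedBall (0 : Space N) 1,
      energyDensity c δ u v τ x = 0 := fun τ hτ x hx =>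
    energyDensity_eq_zero (mul_nonneg hc0 hτ.1) (hnorm x hx)
  have hcont := continuousOn_energyDensity (c := c) (δ := δ) hu hv
  have hslice : ∀ τ ∈ Icc 0 b, Continuous (energyDensity c δ u v τ) := fun τ hτ => by
    rw [← continuousOn_univ]
    exact hcont.comp (f := fun x : Space N => (τ, x)) (by fun_prop) fun x _ => ⟨hsub hτ, trivial⟩
  have hint : ∀ τ ∈ Icc 0 b, Integrable (energyDensity c δ u v τ) := fun τ hτ =>
    integrable_of_continuous_of_eq_zero_off_ball (hslice τ hτ) (hsupp τ hτ)
  have hnonneg : ∀ τ x, 0 ≤ energyDensity c δ u v τ x := fun τ x =>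
    mul_nonneg (weight_nonneg c δ τ x) (sq_nonneg _)
  have hderiv := fun (τ : ℝ) (hτ : τ ∈ Ioo 0 b) =>
    hasDerivAt_integral_of_eq_zero_off_ball (F := energyDensity c δ u v)
      (F' := energyDensityDeriv c δ u v) (R := 1)
      (hcont.mono (prod_mono hsub' subset_rfl))
      ((continuousOn_energyDensityDeriv hu hv).mono (prod_mono hsub' subset_rfl))
      (fun τ hτ => hsupp τ (Ioo_subset_Icc_self hτ))
      (fun τ hτ x hx => energyDensityDeriv_eq_zero (mul_nonneg hc0 hτ.1.le) (hnorm x hx))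
      (fun τ hτ x => hasDerivAt_energyDensity hu hv ⟨hτ.1, hτ.2.trans hb.2⟩ x) hτ
  have hzero : ∫ x, energyDensity c δ u v t x = 0 := by
    refine eq_zero_of_deriv_le_mul (E := fun τ => ∫ x, energyDensity c δ u v τ x)
      (C := (3 * N + 6) * L)
      (continuousOn_integral_of_compact_support (isCompact_closedBall (0 : Space N) 1)
        (hcont.mono (prod_mono hsub subset_rfl)) fun τ x hτ hx => hsupp τ hτ x hx)
      (fun τ hτ => (hderiv τ hτ).2) (fun τ hτ => ?_)
      (fun τ _ => integral_nonneg (hnonneg τ)) ?_ ht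
    · have hτ' := Ioo_subset_Icc_self hτ
      exact integral_energyDensityDeriv_le hu hv hL hc (hsub hτ') (hux τ hτ) (hDu τ hτ')
        (hDv τ hτ') (hderiv τ hτ).1 (hint τ hτ')
    · simp [energyDensity, h0]
  have hae := (integral_eq_zero_iff_of_nonneg (hnonneg t) (hint t ht)).1 hzero
  have hall := ((hslice t ht).ae_eq_iff_eq volume continuous_const).1 hae
  have h00 : energyDensity c δ u v t 0 = 0 := congrFun hall 0
  -- The smallness of δ keeps the origin inside the support of the weight up to time b.
  have hpos : 0 < weight c δ t (0 : Space N) := by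
    refine expNegInvGlue.pos_of_pos ?_
    have hexp : Real.exp (2 * c * t) ≤ Real.exp (2 * (3 * (L + 1)) * b) := by
      rw [← hc]
      exact Real.exp_le_exp.2 (mul_le_mul_of_nonneg_left ht.2 (by positivity))
    have := mul_le_mul_of_nonneg_right hexp (sq_nonneg δ)
    simp only [weightArg, norm_zero]
    linarith
  rcases mul_eq_zero.1 h00 with h | h
  · exact absurd h hpos.ne'
  · exact sub_eq_zero.1 (norm_eq_zero.1 (pow_eq_zero_iff two_ne_zero |>.1 h))

end Energy

variable {T : ℝ} {u : ℝ → Space N → Space N}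

/-! ### Solutions with odd data vanish at the origin -/

namespace IsRegularSolution

lemma exists_bound_fderiv (hu : IsRegularSolution T u) {b : ℝ} (hb : b < T) :
    ∃ L, 0 ≤ L ∧ ∀ t ∈ Icc 0 b, ∀ x, ‖x‖ ≤ 1 → ‖fderiv ℝ (u t) x‖ ≤ L := by
  obtain ⟨C, hC⟩ := ((isCompact_Icc (a := 0) (b := b)).prod
    (isCompact_closedBall (0 : Space N) 1)).exists_bound_of_continuousOn
    (hu.continuousOn_fderiv.mono
      (prod_mono (fun τ hτ => ⟨hτ.1, hτ.2.trans_lt hb⟩) (subset_univ _)))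
  exact ⟨max C 0, le_max_right _ _, fun t ht x hx =>
    (hC (t, x) ⟨ht, by simpa using hx⟩).trans (le_max_left _ _)⟩

lemma norm_sub_origin_le (hu : IsRegularSolution T u) {t L : ℝ} (ht : t ∈ Ico 0 T)
    (hL : ∀ x, ‖x‖ ≤ 1 → ‖fderiv ℝ (u t) x‖ ≤ L) {x : Space N} (hx : ‖x‖ ≤ 1) :
    ‖u t x - u t 0‖ ≤ L * ‖x‖ := by
  have := (convex_closedBall (0 : Space N) 1).norm_image_sub_le_of_norm_fderiv_le (𝕜 := ℝ)
    (f := u t) (C := L) (fun y _ => (hu.hasFDerivAt ht y).differentiableAt)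
    (fun y hy => hL y (by simpa using hy)) (x := 0) (y := x) (by simp) (by simpa using hx)
  simpa using this

lemma continuousOn_at (hu : IsRegularSolution T u) (x : Space N) :
    ContinuousOn (fun t => u t x) (Ico 0 T) :=
  hu.continuousOn.comp (f := fun t : ℝ => (t, x)) (by fun_prop) fun _ ht => ⟨ht, trivial⟩

/-- The solution with odd initial data vanishes at the origin. -/
lemma apply_origin_eq_zero (hu : IsRegularSolution T u) (hodd : ∀ x, u 0 (-x) = -u 0 x) {t : ℝ}
    (ht : t ∈ Ico 0 T) : u t 0 = 0 := by
  obtain ⟨L, hL, hDu⟩ := hu.exists_bound_fderiv ht.2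
  obtain ⟨δ, hδ, hδexp⟩ : ∃ δ : ℝ, 0 < δ ∧ Real.exp (2 * (3 * (L + 1)) * t) * δ ^ 2 < 1 := by
    -- With this δ the product equals 1/4.
    refine ⟨Real.exp (-(3 * (L + 1) * t)) / 2, by positivity, ?_⟩
    have h : Real.exp (2 * (3 * (L + 1)) * t) * Real.exp (-(3 * (L + 1) * t)) ^ 2 = 1 := by
      rw [← Real.exp_nat_mul, ← Real.exp_add, Real.exp_eq_one_iff]
      push_cast
      ring
    rw [div_pow]
    linarith
  -- Bootstrap: |u(τ, 0)| ≤ δ before s improves to u(s, 0) = 0, by comparing u with its reflection.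
  have hstep : ∀ s ∈ Icc 0 t, (∀ τ ∈ Ioo 0 s, ‖u τ 0‖ ≤ δ) → u s 0 = 0 := by
    intro s hs hsmall
    have hsT : ∀ τ ∈ Icc 0 s, τ ∈ Ico 0 T := fun τ hτ =>
      ⟨hτ.1, (hτ.2.trans hs.2).trans_lt ht.2⟩
    have hDu' : ∀ τ ∈ Icc 0 s, ∀ x, ‖x‖ ≤ 1 → ‖fderiv ℝ (u τ) x‖ ≤ L := fun τ hτ =>
      hDu τ ⟨hτ.1, hτ.2.trans hs.2⟩
    have heq := eq_at_origin (δ := δ) hu hu.reflect (by funext x; simp [hodd])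
      (hsT s ⟨hs.1, le_rfl⟩) hL
      (lt_of_le_of_lt (mul_le_mul_of_nonneg_right
        (Real.exp_le_exp.2 (mul_le_mul_of_nonneg_left hs.2 (by positivity))) (sq_nonneg δ)) hδexp)
      (fun τ hτ x hx => ?_) hDu'
      (fun τ hτ x hx => by
        rw [hu.fderiv_reflect (hsT τ hτ)]
        exact hDu' τ hτ (-x) (by simpa using hx))
      (t := s) ⟨hs.1, le_rfl⟩
    · rw [neg_zero, eq_neg_iff_add_eq_zero, ← two_smul ℝ] at heq
      exact (smul_eq_zero_iff_right two_ne_zero).1 heq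
    · have h1 := hu.norm_sub_origin_le (hsT τ (Ioo_subset_Icc_self hτ))
        (hDu' τ (Ioo_subset_Icc_self hτ)) hx
      have h2 := norm_le_norm_sub_add (u τ x) (u τ 0)
      linarith [hsmall τ hτ]
  refine hstep t ⟨ht.1, le_rfl⟩ ?_
  -- Otherwise take the first time s at which |u(s, 0)| ≥ δ; the bootstrap applies up to s and gives
  -- u(s, 0) = 0.
  by_contra! hcon
  obtain ⟨τ, hτ, hτδ⟩ := hcon
  have hcont : ContinuousOn (fun s => ‖u s 0‖) (Icc 0 t) :=
    ((hu.continuousOn_at 0).mono fun s hs => ⟨hs.1, hs.2.trans_lt ht.2⟩).norm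
  have hcompact : IsCompact (Icc 0 t ∩ (fun s => ‖u s 0‖) ⁻¹' Ici δ) :=
    isCompact_Icc.of_isClosed_subset (hcont.preimage_isClosed_of_isClosed isClosed_Icc isClosed_Ici)
      inter_subset_left
  obtain ⟨s, hs, hleast⟩ := hcompact.exists_isLeast ⟨τ, Ioo_subset_Icc_self hτ, hτδ.le⟩
  have hzero : u s 0 = 0 := hstep s hs.1 fun σ hσ => by
    by_contra! hlt
    exact absurd (hleast ⟨⟨hσ.1.le, hσ.2.le.trans hs.1.2⟩, hlt.le⟩) (not_le.2 hσ.2)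
  have : δ ≤ ‖u s 0‖ := hs.2
  rw [hzero, norm_zero] at this
  linarith

/-! ### The Riccati inequality for the divergence at the origin -/

lemma continuousOn_fderiv_origin (hu : IsRegularSolution T u) :
    ContinuousOn (fun t => fderiv ℝ (u t) 0) (Ico 0 T) :=
  hu.continuousOn_fderiv.comp (f := fun t : ℝ => (t, (0 : Space N))) (by fun_prop)
    fun _ ht => ⟨ht, trivial⟩

lemma continuousOn_nonlinearity_fderiv_origin (hu : IsRegularSolution T u) (y : Space N) :
    ContinuousOn (fun t => nonlinearity (fderiv ℝ (u t) 0) (fderiv ℝ (u t) 0 y)) (Ico 0 T) :=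
  Continuous.comp_continuousOn (f := fun t => (fderiv ℝ (u t) 0, fderiv ℝ (u t) 0 y))
    continuous_nonlinearity (hu.continuousOn_fderiv_origin.prodMk
      (hu.continuousOn_fderiv_origin.clm_apply continuousOn_const))

/-- The integrated form of the equation for the Jacobian at a stationary point. -/
lemma fderiv_origin_sub (hu : IsRegularSolution T u) (h0 : ∀ t ∈ Ico 0 T, u t 0 = 0) {b : ℝ}
    (hb : b ∈ Ico 0 T) (y : Space N) :
    fderiv ℝ (u b) 0 y - fderiv ℝ (u 0) 0 y =
      ∫ τ in (0)..b, -nonlinearity (fderiv ℝ (u τ) 0) (fderiv ℝ (u τ) 0 y) := by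
  have hsub : Icc 0 b ⊆ Ico 0 T := fun τ hτ => ⟨hτ.1, hτ.2.trans_lt hb.2⟩
  have h0T : (0 : ℝ) ∈ Ico 0 T := ⟨le_rfl, hb.1.trans_lt hb.2⟩
  have hslope : ∀ t ∈ Ico 0 T,
      Tendsto (fun h : ℝ => h⁻¹ • u t (h • y)) (𝓝[≠] 0) (𝓝 (fderiv ℝ (u t) 0 y)) := by
    intro t ht
    have := ((hu.hasFDerivAt ht 0).hasLineDerivAt y).tendsto_slope_zero
    simpa [h0 t ht] using this
  -- u is only C¹ here, so the equation is not differentiated in x: it is integrated in time at h •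
  -- y, divided by h, and h tends to 0. At h = 0 both sides vanish because 0⁻¹ = 0.
  have hftc : ∀ h : ℝ, h⁻¹ • u b (h • y) - h⁻¹ • u 0 (h • y) =
      ∫ τ in (0)..b, -nonlinearity (fderiv ℝ (u τ) (h • y)) (h⁻¹ • u τ (h • y)) := by
    intro h
    have hcn : ContinuousOn
        (fun τ => nonlinearity (fderiv ℝ (u τ) (h • y)) (u τ (h • y))) (Icc 0 b) :=
      hu.continuousOn_nonlinearity.comp (f := fun t : ℝ => (t, h • y)) (by fun_prop)
        fun _ ht => ⟨hsub ht, trivial⟩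
    have := intervalIntegral.integral_eq_sub_of_hasDerivAt_of_le hb.1
      ((hu.continuousOn_at (h • y)).mono hsub)
      (fun τ hτ => hu.hasDerivAt τ ⟨hτ.1, hτ.2.trans hb.2⟩ (h • y))
      (hcn.neg.intervalIntegrable_of_Icc hb.1)
    rw [← smul_sub, ← this, ← intervalIntegral.integral_smul]
    simp_rw [nonlinearity_smul, smul_neg]
  obtain ⟨L, hL, hDu⟩ := hu.exists_bound_fderiv hb.2
  have hsmall : ∀ᶠ h : ℝ in 𝓝[≠] 0, ‖h • y‖ ≤ 1 := by
    have : Tendsto (fun h : ℝ => ‖h • y‖) (𝓝 0) (𝓝 0) := by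
      have : Continuous fun h : ℝ => ‖h • y‖ := by fun_prop
      simpa using this.tendsto 0
    exact ((this.mono_left nhdsWithin_le_nhds).eventually (gt_mem_nhds one_pos)).mono
      fun _ h => h.le
  have hlim : Tendsto
      (fun h : ℝ => ∫ τ in (0)..b, -nonlinearity (fderiv ℝ (u τ) (h • y)) (h⁻¹ • u τ (h • y)))
      (𝓝[≠] 0)
      (𝓝 (∫ τ in (0)..b, -nonlinearity (fderiv ℝ (u τ) 0) (fderiv ℝ (u τ) 0 y))) := by
    -- Since u(τ, 0) = 0, the mean value inequality bounds the difference quotient by L‖y‖,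
    -- uniformly in h.
    refine intervalIntegral.tendsto_integral_filter_of_dominated_convergence
      (fun _ => (N + 2) * L * (L * ‖y‖)) ?_ ?_ (by simp) ?_
    · refine Eventually.of_forall fun h => ?_
      rw [uIoc_of_le hb.1]
      have hc : ContinuousOn
          (fun τ => -nonlinearity (fderiv ℝ (u τ) (h • y)) (h⁻¹ • u τ (h • y))) (Icc 0 b) := by
        simp_rw [nonlinearity_smul]
        exact ((continuousOn_const (c := h⁻¹)).smul
          (hu.continuousOn_nonlinearity.comp (f := fun t : ℝ => (t, h • y)) (by fun_prop)
            fun _ ht => ⟨hsub ht, trivial⟩)).neg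
      exact (hc.mono Ioc_subset_Icc_self).aestronglyMeasurable measurableSet_Ioc
    · filter_upwards [hsmall, self_mem_nhdsWithin] with h hh hne
      refine Eventually.of_forall fun τ hτ => ?_
      rw [uIoc_of_le hb.1] at hτ
      have hτ' := Ioc_subset_Icc_self hτ
      have h1 := hu.norm_sub_origin_le (hsub hτ') (hDu τ hτ') hh
      rw [h0 τ (hsub hτ'), sub_zero, norm_smul] at h1
      have h2 : ‖h⁻¹ • u τ (h • y)‖ ≤ L * ‖y‖ := by
        have hpos : 0 < ‖h‖ := norm_pos_iff.2 hne
        rw [norm_smul, norm_inv, inv_mul_le_iff₀ hpos]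
        linarith
      rw [norm_neg]
      refine (norm_nonlinearity_le _ _).trans ?_
      gcongr
      exact hDu τ hτ' _ hh
    · refine Eventually.of_forall fun τ hτ => ?_
      rw [uIoc_of_le hb.1] at hτ
      have hτ' := hsub (Ioc_subset_Icc_self hτ)
      have h1 : Tendsto (fun h : ℝ => fderiv ℝ (u τ) (h • y)) (𝓝[≠] 0)
          (𝓝 (fderiv ℝ (u τ) 0)) := by
        have hc : Continuous fun h : ℝ => fderiv ℝ (u τ) (h • y) :=
          ((hu.contDiff hτ').continuous_fderiv one_ne_zero).comp (by fun_prop)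
        have := hc.tendsto 0
        rw [zero_smul] at this
        exact this.mono_left nhdsWithin_le_nhds
      exact ((continuous_nonlinearity.tendsto _).comp (h1.prodMk_nhds (hslope τ hτ'))).neg
  refine tendsto_nhds_unique ?_ hlim
  simp_rw [← hftc]
  exact (hslope b hb).sub (hslope 0 h0T)

/-- The integrand in `fderiv_origin_sub` is continuous in time, so the fundamental theorem of
calculus applies. -/
lemma hasDerivAt_fderiv_origin (hu : IsRegularSolution T u) (h0 : ∀ t ∈ Ico 0 T, u t 0 = 0)
    {t : ℝ} (ht : t ∈ Ioo 0 T) (y : Space N) :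
    HasDerivAt (fun τ => fderiv ℝ (u τ) 0 y)
      (-nonlinearity (fderiv ℝ (u t) 0) (fderiv ℝ (u t) 0 y)) t := by
  have hc : ContinuousOn
      (fun τ => -nonlinearity (fderiv ℝ (u τ) 0) (fderiv ℝ (u τ) 0 y)) (Ico 0 T) :=
    (hu.continuousOn_nonlinearity_fderiv_origin y).neg
  have hint := intervalIntegral.integral_hasDerivAt_right
    ((hc.mono fun τ hτ => ⟨hτ.1, hτ.2.trans_lt ht.2⟩).intervalIntegrable_of_Icc ht.1.le)
    ((hc.mono Ioo_subset_Ico_self).stronglyMeasurableAtFilter isOpen_Ioo t ht)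
    (hc.continuousAt (Ico_mem_nhds ht.1 ht.2))
  refine (hint.const_add (fderiv ℝ (u 0) 0 y)).congr_of_eventuallyEq ?_
  filter_upwards [isOpen_Ioo.mem_nhds ht] with τ hτ
  rw [← hu.fderiv_origin_sub h0 (Ioo_subset_Ico_self hτ) y]
  abel

end IsRegularSolution

lemma adjoint_apply_coord (A : Space N →L[ℝ] Space N) (z : Space N) (i : Fin N) :
    A.adjoint z i = ⟪z, A (EuclideanSpace.single i 1)⟫_ℝ := by
  have h := ContinuousLinearMap.adjoint_inner_left A (EuclideanSpace.single i (1 : ℝ)) z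
  rw [← h, EuclideanSpace.inner_single_right]
  simp

lemma apply_coord (A : Space N →L[ℝ] Space N) (z : Space N) (i : Fin N) :
    A z i = ∑ j, z j * A (EuclideanSpace.single j 1) i := by
  conv_lhs => rw [← sum_smul_single z]
  simp

/-- The squared trace is dominated by the quadratic form governing the divergence. -/
lemma sq_trace_le (A : Space N →L[ℝ] Space N) :
    trace A ^ 2 ≤ ∑ i, nonlinearity A (A (EuclideanSpace.single i 1)) i := by
  set a : Fin N → Fin N → ℝ := fun i j => A (EuclideanSpace.single i 1) j with ha
  have h1 : ∀ i, nonlinearity A (A (EuclideanSpace.single i 1)) i =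
      ∑ j, a i j * a j i + trace A * a i i + ∑ j, a i j ^ 2 := by
    intro i
    simp only [nonlinearity, PiLp.add_apply, PiLp.smul_apply, smul_eq_mul, adjoint_apply_coord,
      real_inner_self_eq_norm_sq, EuclideanSpace.real_norm_sq_eq, ha]
    rw [apply_coord]
  have hswap : ∑ i, ∑ j, a i j ^ 2 = ∑ i, ∑ j, a j i ^ 2 := Finset.sum_comm
  -- The excess over (tr A)² is half the squared Frobenius norm of A + Aᵀ.
  have hsq : 0 ≤ ∑ i, ∑ j, (a i j + a j i) ^ 2 :=
    Finset.sum_nonneg fun i _ => Finset.sum_nonneg fun j _ => sq_nonneg _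
  have hexpand : ∑ i, ∑ j, (a i j + a j i) ^ 2 =
      2 * (∑ i, ∑ j, a i j * a j i + ∑ i, ∑ j, a i j ^ 2) := by
    have : ∀ i j, (a i j + a j i) ^ 2 = 2 * (a i j * a j i) + a i j ^ 2 + a j i ^ 2 :=
      fun i j => by ring
    simp_rw [this, Finset.sum_add_distrib, ← hswap, ← Finset.mul_sum]
    ring
  have htr : trace A = ∑ i, a i i := rfl
  simp_rw [h1, Finset.sum_add_distrib, ← Finset.mul_sum, ← htr]
  nlinarith

/-- A function with `d' ≤ -d²` and `d(0) < 0` does not exist up to time `1 / |d(0)|`. -/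
lemma le_inv_abs_of_deriv_le_neg_sq {d d' : ℝ → ℝ} (hc : ContinuousOn d (Ico 0 T))
    (hd : ∀ t ∈ Ioo 0 T, HasDerivAt d (d' t) t) (hle : ∀ t ∈ Ioo 0 T, d' t ≤ -d t ^ 2)
    (h0 : d 0 < 0) : T ≤ 1 / |d 0| := by
  by_contra! hT
  set b := 1 / |d 0| with hb
  have hb0 : 0 < b := by have := abs_pos.2 h0.ne; positivity
  have hsub : Icc 0 b ⊆ Ico 0 T := fun τ hτ => ⟨hτ.1, hτ.2.trans_lt hT⟩
  have hsub' : ∀ τ ∈ interior (Icc 0 b), τ ∈ Ioo 0 T := fun τ hτ => by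
    rw [interior_Icc] at hτ
    exact ⟨hτ.1, hτ.2.trans hT⟩
  have hanti : AntitoneOn d (Icc 0 b) :=
    antitoneOn_of_hasDerivWithinAt_nonpos (convex_Icc 0 b) (hc.mono hsub)
      (fun τ hτ => (hd τ (hsub' τ hτ)).hasDerivWithinAt)
      fun τ hτ => (hle τ (hsub' τ hτ)).trans (neg_nonpos.2 (sq_nonneg _))
  have hneg : ∀ τ ∈ Icc 0 b, d τ < 0 := fun τ hτ =>
    (hanti (left_mem_Icc.2 hb0.le) hτ hτ.1).trans_lt h0
  -- (1/d)' = -d'/d² ≥ 1, so at b = 1/|d(0)| one would have 1/d(b) ≥ 1/d(0) + b = 0, although d(b) <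
  -- 0.
  have hmono : MonotoneOn (fun τ => (d τ)⁻¹ - τ) (Icc 0 b) := by
    refine monotoneOn_of_hasDerivWithinAt_nonneg (convex_Icc 0 b)
      (f' := fun τ => -d' τ / d τ ^ 2 - 1)
      (((hc.mono hsub).inv₀ fun τ hτ => (hneg τ hτ).ne).sub continuousOn_id) ?_ ?_
    · intro τ hτ
      exact (((hd τ (hsub' τ hτ)).inv (hneg τ (interior_subset hτ)).ne).sub
        (hasDerivAt_id τ)).hasDerivWithinAt
    · intro τ hτ
      have hpos : 0 < d τ ^ 2 := sq_pos_of_neg (hneg τ (interior_subset hτ))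
      have := hle τ (hsub' τ hτ)
      rw [sub_nonneg, le_div_iff₀ hpos]
      linarith
  have h1 := hmono (left_mem_Icc.2 hb0.le) (right_mem_Icc.2 hb0.le) hb0.le
  have h2 : (d b)⁻¹ < 0 := inv_lt_zero.2 (hneg b (right_mem_Icc.2 hb0.le))
  have h3 : b = -(d 0)⁻¹ := by rw [hb, abs_of_neg h0, one_div, inv_neg]
  simp only at h1
  linarith

/-- A regular solution with odd data whose divergence is negative at the origin breaks down. -/
lemma IsRegularSolution.time_le (hu : IsRegularSolution T u) (hodd : ∀ x, u 0 (-x) = -u 0 x)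
    (hdiv : trace (fderiv ℝ (u 0) 0) < 0) : T ≤ 1 / |trace (fderiv ℝ (u 0) 0)| := by
  have h0 : ∀ t ∈ Ico 0 T, u t 0 = 0 := fun t ht => hu.apply_origin_eq_zero hodd ht
  refine le_inv_abs_of_deriv_le_neg_sq (d := fun t => trace (fderiv ℝ (u t) 0))
    (d' := fun t => ∑ i, -nonlinearity (fderiv ℝ (u t) 0)
      (fderiv ℝ (u t) 0 (EuclideanSpace.single i 1)) i)
    (continuous_trace.comp_continuousOn hu.continuousOn_fderiv_origin) ?_ ?_ hdiv
  · intro t ht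
    unfold trace
    refine HasDerivAt.fun_sum fun i _ => ?_
    exact (EuclideanSpace.proj (𝕜 := ℝ) i).hasFDerivAt.comp_hasDerivAt t
      (hu.hasDerivAt_fderiv_origin h0 ht (EuclideanSpace.single i 1))
  · intro t ht
    simp only [Finset.sum_neg_distrib]
    exact neg_le_neg (sq_trace_le _)

/-! ### Classical solutions -/

lemma divergence_eq_trace {v : Space N → Space N} {x : Space N} (hv : DifferentiableAt ℝ v x) :
    divergence v x = trace (fderiv ℝ v x) := by
  unfold divergence trace partialDeriv
  refine Finset.sum_congr rfl fun i _ => ?_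
  have h := (EuclideanSpace.proj (𝕜 := ℝ) i).hasFDerivAt.comp x hv.hasFDerivAt
  have h' : fderiv ℝ (fun y => v y i) x = _ := h.fderiv
  rw [h']
  rfl

/-- The nonlinearity in coordinates. -/
lemma nonlinearity_coord {v : Space N → Space N} {x : Space N} (hv : DifferentiableAt ℝ v x)
    (i : Fin N) :
    ∑ j, partialDeriv j (fun y => v y i * v y j) x +
      (1 / 2) * partialDeriv i (fun y => ‖v y‖ ^ 2) x =
    nonlinearity (fderiv ℝ v x) (v x) i := by
  have hcoord : ∀ j, HasFDerivAt (fun y => v y j)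
      ((EuclideanSpace.proj (𝕜 := ℝ) j).comp (fderiv ℝ v x)) x := fun j =>
    (EuclideanSpace.proj (𝕜 := ℝ) j).hasFDerivAt.comp x hv.hasFDerivAt
  have h1 : ∀ j, partialDeriv j (fun y => v y i * v y j) x =
      v x j * fderiv ℝ v x (EuclideanSpace.single j 1) i +
        fderiv ℝ v x (EuclideanSpace.single j 1) j * v x i := by
    intro j
    rw [partialDeriv, ((hcoord i).fun_mul (hcoord j)).fderiv]
    simp
    ring
  have h2 : partialDeriv i (fun y => ‖v y‖ ^ 2) x =
      2 * ⟪v x, fderiv ℝ v x (EuclideanSpace.single i 1)⟫_ℝ := by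
    rw [partialDeriv, hv.hasFDerivAt.norm_sq.fderiv]
    simp
  simp only [nonlinearity, PiLp.add_apply, PiLp.smul_apply, smul_eq_mul, adjoint_apply_coord]
  rw [apply_coord, h2]
  simp_rw [h1, Finset.sum_add_distrib, ← Finset.sum_mul]
  simp only [trace]
  ring

/-- Joint differentiability at interior times lets the coordinate equations be assembled into one
vector-valued derivative. -/
lemma IsClassicalSolution.isRegularSolution {s : ℝ} {u₀ : Space N → Space N}
    (hu : IsClassicalSolution s u₀ T u) : IsRegularSolution T u where
  contDiffOn := hu.contDiffOn
  hasDerivAt t ht x := by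
    have hnhds : Ico 0 T ×ˢ (univ : Set (Space N)) ∈ 𝓝 (t, x) :=
      prod_mem_nhds (Ico_mem_nhds ht.1 ht.2) univ_mem
    have hdiff : DifferentiableAt ℝ (fun p : ℝ × Space N => u p.1 p.2) (t, x) :=
      (hu.contDiffOn.contDiffAt hnhds).differentiableAt one_ne_zero
    have htime : DifferentiableAt ℝ (fun τ => u τ x) t :=
      hdiff.comp t (f := fun τ : ℝ => (τ, x)) (by fun_prop)
    have hspace : DifferentiableAt ℝ (u t) x :=
      hdiff.comp x (f := fun y : Space N => (t, y)) (by fun_prop)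
    refine htime.hasDerivAt.congr_deriv ?_
    ext i
    have hi : HasDerivAt (fun τ => u τ x i) (deriv (fun τ => u τ x) t i) t :=
      (EuclideanSpace.proj (𝕜 := ℝ) i).hasFDerivAt.comp_hasDerivAt t htime.hasDerivAt
    have heq := hu.equation t ht x i
    rw [hi.deriv, add_assoc, nonlinearity_coord hspace i] at heq
    rw [PiLp.neg_apply]
    linarith

end ZeroDispersion

end

theorem theorem3 (N : ℕ) (k : ℝ) (hk : (N : ℝ) / 2 + 2 < k)
    (u₀ : ZeroDispersion.Space N → ZeroDispersion.Space N)
    (hu₀ : ZeroDispersion.MemHs k u₀) (hcont : Continuous u₀)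
    (hodd : ∀ x, u₀ (-x) = -u₀ x)
    (hdiv : ZeroDispersion.divergence u₀ 0 < 0) :
    ZeroDispersion.maximalTime k u₀ < ⊤ ∧
      ZeroDispersion.maximalTime k u₀ ≤
        ENNReal.ofReal (1 / |ZeroDispersion.divergence u₀ 0|) := by
  have hle : ZeroDispersion.maximalTime k u₀ ≤
      ENNReal.ofReal (1 / |ZeroDispersion.divergence u₀ 0|) := by
    -- The bound holds for every admissible T, hence for the supremum.
    refine iSup₂_le fun T hT => ENNReal.ofReal_le_ofReal ?_
    obtain ⟨u, hu⟩ := hT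
    have hreg := hu.isRegularSolution
    have hinit := hu.initial
    -- With u₀ replaced by `u 0`, differentiability of the data at the origin comes from the
    -- solution.
    subst hinit
    have hdiff := (hreg.hasFDerivAt (left_mem_Ico.2 hu.pos) 0).differentiableAt
    rw [ZeroDispersion.divergence_eq_trace hdiff] at hdiv ⊢
    exact hreg.time_le hodd hdiv
  exact ⟨hle.trans_lt ENNReal.ofReal_lt_top, hle⟩
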